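/- Let $V$ be a non-singular projective curve over $\mathbb C$ and let $\mathcal E$ be a vector bundle of rank $r$ on $V$. Assume that the dual bundle $\mathcal E^{\vee}$ is semi-positive, i.e. that the tautological line bundle $\mathcal O_{\mathbb P_V(\mathcal E^{\vee})}(1)$ is nef on the projective bundle $\mathbb P_V(\mathcal E^{\vee})$ of rank one quotients of $\mathcal E^{\vee}$. Then $h^0(V,\mathcal E)=\dim_{\mathbb C}H^0(V,\mathcal E)\le r$. Moreover, if $h^0(V,\mathcal E)=r$, then $\mathcal E$ is trivial, i.e. $\mathcal E\simeq\mathcal O_V^{\oplus r}$. -/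

import Mathlib

open CategoryTheory AlgebraicGeometry TopologicalSpace Opposite

noncomputable section

namespace SemiPositive

universe u

/-! ### The dual of a sheaf of modules -/

section Dual

variable {X : Scheme.{u}}

/-- Restriction of a section of an `𝒪_X`-module `M` from `W` to a smaller open set `W'`. -/
def res (M : X.Modules) {W' W : X.Opens} (h : W' ≤ W) (m : Γ(M, W)) : Γ(M, W') :=
  M.presheaf.map (homOfLE h).op m

/-- Restriction of a function from `W` to a smaller open set `W'`. -/
def resO {W' W : X.Opens} (h : W' ≤ W) (a : Γ(X, W)) : Γ(X, W') :=
  X.presheaf.map (homOfLE h).op a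

section lemmas

variable (M : X.Modules) {W'' W' W : X.Opens}

lemma res_self (h : W ≤ W) (m : Γ(M, W)) : res M h m = m := by
  simp [res]

lemma res_res (h : W'' ≤ W') (h' : W' ≤ W) (m : Γ(M, W)) :
    res M h (res M h' m) = res M (h.trans h') m := by
  have : (homOfLE (h.trans h')).op = (homOfLE h').op ≫ (homOfLE h).op := rfl
  simp [res, this]

lemma res_add (h : W' ≤ W) (m n : Γ(M, W)) : res M h (m + n) = res M h m + res M h n :=
  map_add _ _ _

lemma res_smul (h : W' ≤ W) (a : Γ(X, W)) (m : Γ(M, W)) :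
    res M h (a • m) = resO h a • res M h m :=
  Scheme.Modules.map_smul M _ _ _

lemma resO_self (h : W ≤ W) (m : Γ(X, W)) : resO h m = m := by
  simp [resO]

lemma resO_resO (h : W'' ≤ W') (h' : W' ≤ W) (m : Γ(X, W)) :
    resO h (resO h' m) = resO (h.trans h') m := by
  have : (homOfLE (h.trans h')).op = (homOfLE h').op ≫ (homOfLE h).op := rfl
  simp [resO, this]

lemma resO_add (h : W' ≤ W) (m n : Γ(X, W)) : resO h (m + n) = resO h m + resO h n :=
  map_add (X.presheaf.map (homOfLE h).op).hom _ _

lemma resO_neg (h : W' ≤ W) (m : Γ(X, W)) : resO h (-m) = -resO h m :=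
  map_neg (X.presheaf.map (homOfLE h).op).hom _

lemma resO_zero (h : W' ≤ W) : resO h (0 : Γ(X, W)) = 0 :=
  map_zero (X.presheaf.map (homOfLE h).op).hom

lemma resO_one (h : W' ≤ W) : resO h (1 : Γ(X, W)) = 1 :=
  map_one (X.presheaf.map (homOfLE h).op).hom

lemma resO_mul (h : W' ≤ W) (m n : Γ(X, W)) : resO h (m * n) = resO h m * resO h n :=
  map_mul (X.presheaf.map (homOfLE h).op).hom _ _

/-- Two functions on `W` agree if they agree locally. -/
lemma resO_ext {ι : Type u} (U : ι → X.Opens) (hU : W ≤ iSup U) {a b : Γ(X, W)}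
    (h : ∀ i, resO (inf_le_left : W ⊓ U i ≤ W) a = resO (inf_le_left : W ⊓ U i ≤ W) b) :
    a = b :=
  X.sheaf.eq_of_locally_eq' (fun i => W ⊓ U i) W (fun _ => homOfLE inf_le_left)
    (by rw [← inf_iSup_eq]; exact le_inf le_rfl hU) a b h

/-- A compatible family of functions on a cover of `W` glues. -/
lemma resO_glue {ι : Type u} (U : ι → X.Opens) (hU : W ≤ iSup U)
    (a : ∀ i, Γ(X, W ⊓ U i))
    (h : ∀ i j, resO (inf_le_left : (W ⊓ U i) ⊓ (W ⊓ U j) ≤ W ⊓ U i) (a i) =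
      resO (inf_le_right : (W ⊓ U i) ⊓ (W ⊓ U j) ≤ W ⊓ U j) (a j)) :
    ∃ b : Γ(X, W), ∀ i, resO (inf_le_left : W ⊓ U i ≤ W) b = a i := by
  obtain ⟨b, hb, -⟩ := X.sheaf.existsUnique_gluing' (fun i => W ⊓ U i) W
    (fun _ => homOfLE inf_le_left) (by rw [← inf_iSup_eq]; exact le_inf le_rfl hU) a h
  exact ⟨b, hb⟩

end lemmas

/-- A section over `U` of the sheaf `ℋom(E, 𝒪_X)`: a morphism of sheaves of modules `E|_U → 𝒪_U`,
i.e. a family of `𝒪_X(W)`-linear maps `E(W) → 𝒪_X(W)` for the open sets `W ⊆ U` which is compatible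
with restriction. -/
@[ext]
structure DualSection (E : X.Modules) (U : X.Opens) where
  /-- the linear map over each open subset of `U` -/
  app : ∀ W : X.Opens, W ≤ U → (Γ(E, W) →ₗ[Γ(X, W)] Γ(X, W))
  /-- compatibility with restriction -/
  naturality : ∀ (W W' : X.Opens) (hW : W ≤ U) (h : W' ≤ W) (m : Γ(E, W)),
    resO h (app W hW m) = app W' (h.trans hW) (res E h m)

namespace DualSection

variable {E : X.Modules} {U : X.Opens}

instance : Zero (DualSection E U) where
  zero := ⟨fun _ _ => 0, fun _ _ _ _ _ => by simp [resO_zero]⟩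

instance : Add (DualSection E U) where
  add φ ψ := ⟨fun W hW => φ.app W hW + ψ.app W hW, fun _ _ _ _ _ => by
    simp [resO_add, φ.naturality, ψ.naturality]⟩

instance : Neg (DualSection E U) where
  neg φ := ⟨fun W hW => -φ.app W hW, fun _ _ _ _ _ => by
    simp [resO_neg, φ.naturality]⟩

instance : SMul Γ(X, U) (DualSection E U) where
  smul a φ := ⟨fun W hW => resO hW a • φ.app W hW, fun _ _ _ _ _ => by
    simp [resO_mul, resO_resO, φ.naturality]⟩

@[simp] lemma zero_app (W : X.Opens) (hW : W ≤ U) : (0 : DualSection E U).app W hW = 0 := rfl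
@[simp] lemma add_app (φ ψ : DualSection E U) (W : X.Opens) (hW : W ≤ U) :
    (φ + ψ).app W hW = φ.app W hW + ψ.app W hW := rfl
@[simp] lemma neg_app (φ : DualSection E U) (W : X.Opens) (hW : W ≤ U) :
    (-φ).app W hW = -φ.app W hW := rfl
@[simp] lemma smul_app (a : Γ(X, U)) (φ : DualSection E U) (W : X.Opens) (hW : W ≤ U) :
    (a • φ).app W hW = resO hW a • φ.app W hW := rfl

instance : AddCommGroup (DualSection E U) where
  add_assoc _ _ _ := by ext; simp [add_assoc]
  zero_add _ := by ext; simp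
  add_zero _ := by ext; simp
  neg_add_cancel _ := by ext; simp
  add_comm _ _ := by ext; simp [add_comm]
  nsmul := nsmulRec
  zsmul := zsmulRec

instance : Module Γ(X, U) (DualSection E U) where
  one_smul _ := by ext; simp [resO_one]
  mul_smul _ _ _ := by ext; simp [resO_mul, mul_assoc]
  smul_zero _ := by ext; simp
  smul_add _ _ _ := by ext; simp
  add_smul _ _ _ := by ext; simp [resO_add, add_mul]
  zero_smul _ := by ext; simp [resO_zero]

/-- Restriction of a section of `ℋom(E, 𝒪_X)`. -/
def restrict {U' : X.Opens} (h : U' ≤ U) : DualSection E U →+ DualSection E U' where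
  toFun φ := ⟨fun W hW => φ.app W (hW.trans h), fun W W' _ h' m => φ.naturality W W' _ h' m⟩
  map_zero' := rfl
  map_add' _ _ := rfl

end DualSection

/-- The presheaf of abelian groups `U ↦ Hom(E|_U, 𝒪_U)`. -/
def dualPresheaf (E : X.Modules) : TopCat.Presheaf Ab X where
  obj U := .of (DualSection E U.unop)
  map i := AddCommGrpCat.ofHom (DualSection.restrict (leOfHom i.unop))
  map_id _ := rfl
  map_comp _ _ := rfl

instance (E : X.Modules) (U : (Opens X)ᵒᵖ) :
    Module (X.ringCatSheaf.obj.obj U) ((dualPresheaf E).obj U) :=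
  inferInstanceAs (Module Γ(X, U.unop) (DualSection E U.unop))

lemma dualPresheaf_isSheaf (E : X.Modules) : (dualPresheaf E).IsSheaf := by
  rw [TopCat.Presheaf.isSheaf_iff_isSheafUniqueGluing]
  intro ι U sf' hsf
  let sf : ∀ i, DualSection E (U i) := sf'
  have hc : ∀ i j (W : X.Opens) (hi : W ≤ U i) (hj : W ≤ U j), (sf i).app W hi = (sf j).app W hj :=
    fun i j W hi hj =>
      congrArg (fun φ : DualSection E (U i ⊓ U j) => φ.app W (le_inf hi hj)) (hsf i j)
  have key : ∀ (W : X.Opens) (hW : W ≤ iSup U) (m : Γ(E, W)), ∃ b : Γ(X, W), ∀ i,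
      resO (inf_le_left : W ⊓ U i ≤ W) b =
        (sf i).app (W ⊓ U i) inf_le_right (res E inf_le_left m) := by
    intro W hW m
    refine resO_glue U hW _ fun i j => ?_
    rw [(sf i).naturality, (sf j).naturality, res_res, res_res]
    exact DFunLike.congr_fun (hc i j _ _ _) _
  choose g hg using key
  let φ : DualSection E (iSup U) :=
    { app := fun W hW =>
        { toFun := g W hW
          map_add' := fun m n => resO_ext U hW fun i => by
            rw [resO_add, hg, hg, hg, res_add, map_add]
          map_smul' := fun a m => resO_ext U hW fun i => by
            rw [RingHom.id_apply, smul_eq_mul, resO_mul, hg, hg, res_smul, map_smul, smul_eq_mul] }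
      naturality := fun W W' hW h m => resO_ext U (h.trans hW) fun i => by
        change resO _ (resO h (g W hW m)) = resO _ (g W' (h.trans hW) (res E h m))
        rw [hg, resO_resO, res_res,
          ← resO_resO (inf_le_inf_right (U i) h : W' ⊓ U i ≤ W ⊓ U i) inf_le_left, hg,
          (sf i).naturality, res_res] }
  have hφ : ∀ i (W : X.Opens) (hW : W ≤ U i) (m : Γ(E, W)),
      g W (hW.trans (le_iSup U i)) m = (sf i).app W hW m := by
    intro i W hW m
    refine resO_ext U (hW.trans (le_iSup U i)) fun j => ?_
    rw [hg, (sf i).naturality]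
    exact DFunLike.congr_fun (hc j i _ _ _) _
  refine ⟨φ, fun i => ?_, fun ψ' hψ' => ?_⟩
  · refine DualSection.ext ?_
    funext W hW
    exact LinearMap.ext fun m => hφ i W hW m
  · let ψ : DualSection E (iSup U) := ψ'
    have hψ : ∀ i (W : X.Opens) (hW : W ≤ U i),
        ψ.app W (hW.trans (le_iSup U i)) = (sf i).app W hW :=
      fun i W hW => congrArg (fun φ : DualSection E (U i) => φ.app W hW) (hψ' i)
    refine DualSection.ext ?_
    funext W hW
    refine LinearMap.ext fun m => resO_ext U hW fun i => ?_
    change resO _ (ψ.app W hW m) = resO _ (g W hW m)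
    rw [hg, ψ.naturality, hψ]

/-- The dual `E^∨ = ℋom(E, 𝒪_X)` of a sheaf of modules. -/
def dual (E : X.Modules) : X.Modules where
  val := PresheafOfModules.ofPresheaf (R := X.ringCatSheaf.obj) (dualPresheaf E) (by
    intro U V f r m
    let φ : DualSection E U.unop := m
    let a : Γ(X, U.unop) := r
    have h : V.unop ≤ U.unop := leOfHom f.unop
    change DualSection.restrict h (a • φ) = resO h a • DualSection.restrict h φ
    refine DualSection.ext ?_
    funext W hW
    change resO (hW.trans h) a • φ.app W (hW.trans h) = resO hW (resO h a) • φ.app W (hW.trans h)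
    rw [resO_resO])
  isSheaf := dualPresheaf_isSheaf E

end Dual

/-! ### Vector bundles and their sections -/

section VectorBundle

variable {X : Scheme.{u}}

/-- The free sheaf of modules `𝒪_X^r`. -/
def free (X : Scheme.{u}) (r : ℕ) : X.Modules :=
  SheafOfModules.free (R := X.ringCatSheaf) (ULift.{u} (Fin r))

/-- `E` is a vector bundle of rank `r`: it is locally isomorphic to `𝒪_X^r`. -/
def IsVectorBundle (E : X.Modules) (r : ℕ) : Prop :=
  ∀ x : X, ∃ U : X.Opens, x ∈ U ∧ Nonempty (E.restrict U.ι ≅ free (U : Scheme.{u}) r)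

/-- `E` is the trivial bundle of rank `r`. -/
def IsTrivial (E : X.Modules) (r : ℕ) : Prop :=
  Nonempty (E ≅ free X r)

/-- A line bundle is a vector bundle of rank one. -/
abbrev IsLineBundle (L : X.Modules) : Prop := IsVectorBundle L 1

/-- `e` trivializes `L` over `W`: multiplication by `e` is an isomorphism `𝒪_W → L|_W`. -/
def IsGenerator (L : X.Modules) {W : X.Opens} (e : Γ(L, W)) : Prop :=
  ∀ (W' : X.Opens) (h : W' ≤ W), Function.Bijective fun a : Γ(X, W') => a • res L h e

end VectorBundle

/-- The dimension `h⁰(X, E)` of the complex vector space of global sections of `E`, for a scheme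
`X` over `ℂ`, as a cardinal number. -/
def h0 {X : Scheme.{0}} (p : X ⟶ Spec (.of ℂ)) (E : X.Modules) : Cardinal.{0} :=
  letI : Module ℂ Γ(E, (⊤ : X.Opens)) :=
    Module.compHom _ ((Scheme.ΓSpecIso (.of ℂ)).inv ≫ p.appTop).hom
  Module.rank ℂ Γ(E, (⊤ : X.Opens))

/-! ### Curves, degrees and nef line bundles -/

/-- `C` is a complete curve over `ℂ`: it is integral, proper over `ℂ` and of dimension one. -/
structure IsCompleteCurve {C : Scheme.{0}} (p : C ⟶ Spec (.of ℂ)) : Prop where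
  isIntegral : IsIntegral C
  isProper : IsProper p
  dim_eq_one : topologicalKrullDim C = 1

/-- `C` is a non-singular complete (equivalently, non-singular projective) curve over `ℂ`: a
complete curve all of whose local rings are regular. -/
structure IsNonsingularCompleteCurve {C : Scheme.{0}} (p : C ⟶ Spec (.of ℂ)) : Prop
    extends IsCompleteCurve p where
  regular : ∀ x : C, IsRegularLocalRing (C.presheaf.stalk x)

section Degree

variable {C : Scheme.{u}} [IsIntegral C]

/-- A nonzero rational section of `L`: a nonzero section over a nonempty (that is, containing the
generic point) open set. -/
structure RationalSection (L : C.Modules) where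
  /-- the domain of definition -/
  U : C.Opens
  mem : genericPoint C ∈ U
  /-- the section -/
  s : Γ(L, U)
  ne_zero : s ≠ 0

/-- The rational section `s` of the line bundle `L` has order `n` at `x`: near `x` one has
`s = a • e` for a local generator `e` of `L` and a rational function `a` of order `n` at `x`.
Here Mathlib's `Scheme.ord a x` is the order of vanishing of `a` along `x` if `x` has codimension
one, and `0` otherwise. -/
def RationalSection.HasOrder [IsLocallyNoetherian C] {L : C.Modules} (s : RationalSection L)
    (x : C) (n : ℤ) : Prop :=
  ∃ (W : C.Opens) (_ : x ∈ W) (hW : genericPoint C ∈ W) (e : Γ(L, W)) (_ : IsGenerator L e)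
    (a : Γ(C, s.U ⊓ W)),
    res L (inf_le_left : s.U ⊓ W ≤ s.U) s.s = a • res L (inf_le_right : s.U ⊓ W ≤ W) e ∧
    Scheme.ord (C.presheaf.germ (s.U ⊓ W) (genericPoint C) ⟨s.mem, hW⟩ a : C.functionField) x = n

/-- The line bundle `L` on the complete curve `C` over `ℂ` has degree `d`: there is a nonzero
rational section of `L` whose divisor `∑ nₓ x` has degree `∑ nₓ = d`. (All closed points have
residue field `ℂ`.) -/
def HasDegree [IsLocallyNoetherian C] (L : C.Modules) (d : ℤ) : Prop :=
  ∃ (s : RationalSection L) (D : C →₀ ℤ), (∀ x, s.HasOrder x (D x)) ∧ (D.sum fun _ n => n) = d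

end Degree

/-- The line bundle `L` on the scheme `X` over `ℂ` is nef: its pullback to any complete curve
mapping to `X` has non-negative degree. (A scheme of finite type over `ℂ` is automatically locally
noetherian.) -/
def IsNef {X : Scheme.{0}} (p : X ⟶ Spec (.of ℂ)) (L : X.Modules) : Prop :=
  ∀ (C : Scheme.{0}) [IsIntegral C] [IsLocallyNoetherian C] (f : C ⟶ X),
    IsCompleteCurve (f ≫ p) → ∀ d : ℤ, HasDegree ((Scheme.Modules.pullback f).obj L) d → 0 ≤ d

/-! ### Projective bundles and semi-positivity -/

/-- The projective bundle `π : ℙ_X(E) → X` of one-dimensional quotients of `E`, with its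
tautological line bundle `𝒪(1)` and universal quotient `π^*E → 𝒪(1)`. It is the scheme over `X`
(unique up to unique isomorphism) representing the functor which sends `g : T → X` to the set of
isomorphism classes of line bundle quotients `g^*E → L`. -/
structure ProjectiveBundle {X : Scheme.{u}} (E : X.Modules) where
  /-- the total space -/
  P : Scheme.{u}
  /-- the projection -/
  π : P ⟶ X
  /-- the tautological line bundle -/
  O1 : P.Modules
  isLineBundle : IsLineBundle O1
  /-- the universal quotient -/
  quot : (Scheme.Modules.pullback π).obj E ⟶ O1
  epi_quot : Epi quot
  existsUnique_lift : ∀ {T : Scheme.{u}} (g : T ⟶ X) (L : T.Modules), IsLineBundle L →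
    ∀ q : (Scheme.Modules.pullback g).obj E ⟶ L, Epi q →
      ∃! h : T ⟶ P, ∃ (w : h ≫ π = g) (i : (Scheme.Modules.pullback h).obj O1 ≅ L),
        (Scheme.Modules.pullback h).map quot ≫ i.hom =
          (Scheme.Modules.pullbackComp h π).hom.app E ≫
            (Scheme.Modules.pullbackCongr w).hom.app E ≫ q

/-- The vector bundle `E` on the complete variety `X` over `ℂ` is semi-positive: the tautological
line bundle `𝒪(1)` on the projective bundle `ℙ_X(E)` is nef. -/
def IsSemiPositive {X : Scheme.{0}} (p : X ⟶ Spec (.of ℂ)) (E : X.Modules) : Prop :=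
  ∃ B : ProjectiveBundle E, IsNef (B.π ≫ p) B.O1

end SemiPositive

end

/-! A nonzero global section `s` of `E` defines the evaluation map `E^∨ → 𝒪`, `φ ↦ φ(s)`. Its image
`dualImage E s` is the ideal sheaf of the zero scheme of `s`. The local rings of a nonsingular curve
are principal ideal rings, so this ideal is locally generated by a greatest common divisor `t` of
the coordinates of `s`, and it is a line bundle (`isLineBundle_dualImage`). The constant function
`1` is a rational section of it, of order `-ord t` at each point; hence the image has negative
degree as soon as `s` has a zero (`exists_hasDegree_dualImage`). On the other hand, the quotient
`E^∨ → dualImage E s` is a section of `ℙ(E^∨) → V` along which `𝒪(1)` pulls back to the image, so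
nefness makes this degree non-negative. Therefore a nonzero section vanishes nowhere
(`mem_nonvanishing_of_isSemiPositive`).

It follows that evaluation of global sections at a closed point is injective into a fibre of
dimension `r` over `ℂ`, which is the bound. In case of equality it is bijective at every closed
point, so the determinant of a basis of global sections against a local frame is invertible there,
and the basis is a frame near each closed point (`exists_isFrame_res`). These neighbourhoods cover
`V`, and being a frame is a local property.

Nefness bounds every `d` with `HasDegree L d`, so a single rational section suffices and the
independence of the degree from that choice plays no role. -/

noncomputable section

namespace SemiPositive

universe u

section

variable {X : Scheme.{u}}

/-! ### Morphisms of sheaves of modules -/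

/-- A morphism of sheaves of modules from compatible linear maps on sections. -/
def homMk {M N : X.Modules} (f : ∀ U : X.Opens, Γ(M, U) →ₗ[Γ(X, U)] Γ(N, U))
    (hf : ∀ (U U' : X.Opens) (h : U' ≤ U) (m : Γ(M, U)), res N h (f U m) = f U' (res M h m)) :
    M ⟶ N :=
  SheafOfModules.Hom.mk (PresheafOfModules.homMk
    { app := fun U => AddCommGrpCat.ofHom (f U.unop).toAddMonoidHom
      naturality := fun U V i => by
        ext m
        exact (hf U.unop V.unop (leOfHom i.unop) m).symm }
    (fun U r m => (f U.unop).map_smul r m))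

lemma app_res {M N : X.Modules} (f : M ⟶ N) {U U' : X.Opens} (h : U' ≤ U) (m : Γ(M, U)) :
    f.app U' (res M h m) = res N h (f.app U m) :=
  ConcreteCategory.congr_hom (f.mapPresheaf.naturality (homOfLE h).op) m

/-- An isomorphism of sheaves of modules from compatible linear equivalences on sections. -/
def isoMk {M N : X.Modules} (f : ∀ U : X.Opens, Γ(M, U) ≃ₗ[Γ(X, U)] Γ(N, U))
    (hf : ∀ (U U' : X.Opens) (h : U' ≤ U) (m : Γ(M, U)), res N h (f U m) = f U' (res M h m)) :
    M ≅ N where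
  hom := homMk (fun U => (f U).toLinearMap) hf
  inv := homMk (fun U => (f U).symm.toLinearMap) fun U U' h n => by
    apply (f U').injective
    have := hf U U' h ((f U).symm n)
    simp only [LinearEquiv.coe_coe, LinearEquiv.apply_symm_apply] at this ⊢
    exact this.symm
  hom_inv_id := by
    refine Scheme.Modules.hom_ext _ _ fun U => ?_
    ext m
    exact (f U).symm_apply_apply m
  inv_hom_id := by
    refine Scheme.Modules.hom_ext _ _ fun U => ?_
    ext m
    exact (f U).apply_symm_apply m

/-- Two sections of a sheaf of modules agree if they agree locally. -/
lemma res_ext (M : X.Modules) {W : X.Opens} {m n : Γ(M, W)}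
    (h : ∀ x ∈ W, ∃ (W' : X.Opens) (h : W' ≤ W), x ∈ W' ∧ res M h m = res M h n) : m = n := by
  choose! U hU hxU hmn using h
  refine TopCat.Sheaf.eq_of_locally_eq' (⟨M.presheaf, M.isSheaf⟩ : TopCat.Sheaf Ab X)
    (fun x : W => U x) W (fun x => homOfLE (hU x x.2)) (fun x hx => ?_) m n
    fun x => hmn x x.2
  exact Opens.mem_iSup.2 ⟨⟨x, hx⟩, hxU x hx⟩

lemma resO_ext_of_mem {W : X.Opens} {a b : Γ(X, W)}
    (h : ∀ x ∈ W, ∃ (W' : X.Opens) (h : W' ≤ W), x ∈ W' ∧ resO h a = resO h b) : a = b := by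
  choose! U hU hxU hmn using h
  refine X.sheaf.eq_of_locally_eq'
    (fun x : W => U x) W (fun x => homOfLE (hU x x.2)) (fun x hx => ?_) a b
    fun x => hmn x x.2
  exact Opens.mem_iSup.2 ⟨⟨x, hx⟩, hxU x hx⟩

/-- Functions which are given locally by a uniquely solvable condition glue. -/
lemma exists_glue_of_unique {W : X.Opens} (P : ∀ W' ≤ W, Γ(X, W') → Prop)
    (hres : ∀ (W' W'' : X.Opens) (h : W' ≤ W) (h' : W'' ≤ W') (a : Γ(X, W')),
      P W' h a → P W'' (h'.trans h) (resO h' a))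
    (huniq : ∀ (W' : X.Opens) (h : W' ≤ W) (a b : Γ(X, W')), P W' h a → P W' h b → a = b)
    (hex : ∀ x ∈ W, ∃ (W' : X.Opens) (h : W' ≤ W), x ∈ W' ∧ ∃ a, P W' h a) :
    ∃ b : Γ(X, W), ∀ x ∈ W, ∃ (W' : X.Opens) (h : W' ≤ W), x ∈ W' ∧ P W' h (resO h b) := by
  choose! U hU hxU a ha using hex
  obtain ⟨b, hb, -⟩ := X.sheaf.existsUnique_gluing' (fun x : W => U x) W
    (fun x => homOfLE (hU x x.2)) (fun x hx => Opens.mem_iSup.2 ⟨⟨x, hx⟩, hxU x hx⟩)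
    (fun x => a x) fun x y => huniq _ (inf_le_left.trans (hU x x.2)) _ _
      (hres _ _ (hU x x.2) inf_le_left _ (ha x x.2)) (hres _ _ (hU y y.2) inf_le_right _ (ha y y.2))
  refine ⟨b, fun x hx => ⟨U x, hU x hx, hxU x hx, ?_⟩⟩
  have := hb ⟨x, hx⟩
  change resO (hU x hx) b = a x at this
  rw [this]
  exact ha x hx

/-! ### Frames -/

lemma res_sum (M : X.Modules) {W' W : X.Opens} (h : W' ≤ W) {ι : Type*} (s : Finset ι)
    (m : ι → Γ(M, W)) : res M h (∑ i ∈ s, m i) = ∑ i ∈ s, res M h (m i) :=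
  map_sum (M.presheaf.map (homOfLE h).op).hom _ _

lemma res_zero (M : X.Modules) {W' W : X.Opens} (h : W' ≤ W) : res M h 0 = 0 :=
  map_zero (M.presheaf.map (homOfLE h).op).hom

section Frame

variable (E : X.Modules) {U : X.Opens} {r : ℕ}

/-- The linear map `𝒪(W)^r → E(W)` defined by `r` sections of `E` over `U ⊇ W`. -/
def frameMap (e : Fin r → Γ(E, U)) (W : X.Opens) (h : W ≤ U) :
    (Fin r → Γ(X, W)) →ₗ[Γ(X, W)] Γ(E, W) :=
  Fintype.linearCombination Γ(X, W) fun i => res E h (e i)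

lemma frameMap_apply (e : Fin r → Γ(E, U)) (W : X.Opens) (h : W ≤ U) (a : Fin r → Γ(X, W)) :
    frameMap E e W h a = ∑ i, a i • res E h (e i) := rfl

/-- The sections `e i` form a frame of `E` over `U`. -/
def IsFrame (e : Fin r → Γ(E, U)) : Prop :=
  ∀ (W : X.Opens) (h : W ≤ U), Function.Bijective (frameMap E e W h)

lemma res_frameMap (e : Fin r → Γ(E, U)) {W W' : X.Opens} (h : W ≤ U) (h' : W' ≤ W)
    (a : Fin r → Γ(X, W)) :
    res E h' (frameMap E e W h a) = frameMap E e W' (h'.trans h) fun i => resO h' (a i) := by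
  simp [frameMap_apply, res_sum, res_smul, res_res]

variable {E}

namespace IsFrame

variable {e : Fin r → Γ(E, U)} (he : IsFrame E e)
include he

/-- The coordinates of a section with respect to a frame. -/
def coord (W : X.Opens) (h : W ≤ U) : Γ(E, W) ≃ₗ[Γ(X, W)] (Fin r → Γ(X, W)) :=
  (LinearEquiv.ofBijective _ (he W h)).symm

lemma frameMap_coord {W : X.Opens} (h : W ≤ U) (m : Γ(E, W)) :
    frameMap E e W h (he.coord W h m) = m :=
  (LinearEquiv.ofBijective _ (he W h)).apply_symm_apply m

lemma coord_frameMap {W : X.Opens} (h : W ≤ U) (a : Fin r → Γ(X, W)) :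
    he.coord W h (frameMap E e W h a) = a :=
  (LinearEquiv.ofBijective _ (he W h)).symm_apply_apply a

lemma sum_coord {W : X.Opens} (h : W ≤ U) (m : Γ(E, W)) :
    ∑ i, he.coord W h m i • res E h (e i) = m :=
  he.frameMap_coord h m

lemma coord_res {W W' : X.Opens} (h : W ≤ U) (h' : W' ≤ W) (m : Γ(E, W)) (i : Fin r) :
    he.coord W' (h'.trans h) (res E h' m) i = resO h' (he.coord W h m i) := by
  have := res_frameMap E e h h' (he.coord W h m)
  rw [he.frameMap_coord h] at this
  rw [this, he.coord_frameMap]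

lemma restrict {U' : X.Opens} (h : U' ≤ U) : IsFrame E fun i => res E h (e i) := by
  intro W hW
  convert he W (hW.trans h) using 2
  ext a
  simp [frameMap_apply, res_res]

/-- The coordinate functions of a frame, as sections of the dual. -/
def dualSection (i : Fin r) : DualSection E U where
  app W h := LinearMap.proj i ∘ₗ (he.coord W h).toLinearMap
  naturality _ _ hW h m := (he.coord_res hW h m i).symm

end IsFrame

/-- Sections which form a frame locally form a frame. -/
lemma isFrame_of_local {e : Fin r → Γ(E, U)}
    (h : ∀ x ∈ U, ∃ (U' : X.Opens) (h : U' ≤ U), x ∈ U' ∧ IsFrame E fun i => res E h (e i)) :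
    IsFrame E e := by
  have h' : ∀ x ∈ U, ∃ (U' : X.Opens), x ∈ U' ∧ ∀ (W : X.Opens) (h : W ≤ U), W ≤ U' →
      Function.Bijective (frameMap E e W h) := by
    intro x hx
    obtain ⟨U', hU', hxU', hf⟩ := h x hx
    refine ⟨U', hxU', fun W hW hWU' => ?_⟩
    convert hf W hWU' using 2
    ext a
    simp [frameMap_apply, res_res]
  intro W hW
  -- Injectivity comes first and for every open set: on overlaps it forces the local coordinates of
  -- `m` to agree, so that they glue.
  have inj : ∀ (W : X.Opens) (hW : W ≤ U), Function.Injective (frameMap E e W hW) := by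
    intro W hW a b hab
    funext i
    refine resO_ext_of_mem fun x hx => ?_
    obtain ⟨U', hxU', hf⟩ := h' x (hW hx)
    refine ⟨W ⊓ U', inf_le_left, ⟨hx, hxU'⟩, ?_⟩
    have := congrArg (res E (inf_le_left : W ⊓ U' ≤ W)) hab
    rw [res_frameMap, res_frameMap] at this
    exact congrFun ((hf _ _ inf_le_right).1 this) i
  refine ⟨inj W hW, fun m => ?_⟩
  choose! U' hxU' hf using h'
  have hex : ∀ x : W, ∃ a : Fin r → Γ(X, W ⊓ U' x),
      frameMap E e _ (inf_le_left.trans hW) a = res E inf_le_left m :=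
    fun x => (hf x (hW x.2) _ _ inf_le_right).2 _
  choose a ha using hex
  have hglue : ∀ i, ∃ b : Γ(X, W), ∀ x : W, resO inf_le_left b = a x i := by
    intro i
    obtain ⟨b, hb, -⟩ := X.sheaf.existsUnique_gluing' (fun x : W => W ⊓ U' x) W
      (fun x => homOfLE inf_le_left)
      (fun x hx => Opens.mem_iSup.2 ⟨⟨x, hx⟩, hx, hxU' x (hW hx)⟩) (fun x => a x i) (by
        intro x y
        have hx := res_frameMap E e (inf_le_left.trans hW)
          (inf_le_left : (W ⊓ U' x) ⊓ (W ⊓ U' y) ≤ W ⊓ U' x) (a x)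
        have hy := res_frameMap E e (inf_le_left.trans hW)
          (inf_le_right : (W ⊓ U' x) ⊓ (W ⊓ U' y) ≤ W ⊓ U' y) (a y)
        rw [ha, res_res] at hx hy
        exact congrFun (inj _ _ (hx.symm.trans hy)) i)
    exact ⟨b, hb⟩
  choose b hb using hglue
  refine ⟨b, res_ext E fun x hx => ⟨W ⊓ U' x, inf_le_left, ⟨hx, hxU' x (hW hx)⟩, ?_⟩⟩
  rw [res_frameMap, ← ha ⟨x, hx⟩]
  congr 1
  funext i
  exact hb i ⟨x, hx⟩

/-- Frames are transported by isomorphisms. -/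
lemma IsFrame.map_iso {E' : X.Modules} (f : E ≅ E') {e : Fin r → Γ(E, U)} (he : IsFrame E e) :
    IsFrame E' fun i => f.hom.app U (e i) := by
  intro W h
  have hb : Function.Bijective (f.hom.app W) := by
    rw [← ConcreteCategory.isIso_iff_bijective]
    infer_instance
  convert hb.comp (he W h) using 1
  ext a
  simp [frameMap_apply, ← app_res]

/-- Two bundles with global frames of the same size are isomorphic. -/
lemma nonempty_iso_of_isFrame {E' : X.Modules} {e : Fin r → Γ(E, (⊤ : X.Opens))}
    {e' : Fin r → Γ(E', (⊤ : X.Opens))} (he : IsFrame E e) (he' : IsFrame E' e') :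
    Nonempty (E ≅ E') :=
  ⟨isoMk (fun U => (he.coord U le_top).trans (he'.coord U le_top).symm) fun U U' h m => by
    change res E' h (frameMap E' e' U le_top _) = frameMap E' e' U' le_top _
    rw [res_frameMap]
    congr 1
    funext i
    exact (he.coord_res le_top h m i).symm⟩

end Frame

-- The finite coproduct is a biproduct: projections `π j` are prescribed on the summands by
-- Kronecker deltas. On sections, `ι i ≫ π j` gives injectivity of the frame map and `∑ π i ≫ ι i =
-- 𝟙` gives surjectivity.
open Limits in
lemma exists_isFrame_free (X : Scheme.{u}) (r : ℕ) :
    ∃ e : Fin r → Γ(free X r, (⊤ : X.Opens)), IsFrame (free X r) e := by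
  classical
  let O : X.Modules := SheafOfModules.unit X.ringCatSheaf
  let c : Cofan (fun _ : ULift.{u} (Fin r) => O) :=
    Cofan.mk (free X r) fun i => SheafOfModules.ιFree (R := X.ringCatSheaf) i
  have hc : IsColimit c := SheafOfModules.isColimitFreeCofan (R := X.ringCatSheaf) _
  let ι : Fin r → (O ⟶ free X r) := fun i => c.inj ⟨i⟩
  let π : Fin r → (free X r ⟶ O) := fun i =>
    Cofan.IsColimit.desc hc fun j => if j.down = i then 𝟙 O else 0
  have hιπ : ∀ i j, ι i ≫ π j = if i = j then 𝟙 O else 0 := fun i j =>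
    Cofan.IsColimit.fac hc _ _
  have hπι : ∑ i, π i ≫ ι i = 𝟙 (free X r) := by
    refine Cofan.IsColimit.hom_ext hc _ _ fun ⟨j⟩ => ?_
    change ι j ≫ _ = ι j ≫ _
    rw [Preadditive.comp_sum, Finset.sum_eq_single j]
    · rw [← Category.assoc, hιπ, if_pos rfl]; simp
    · intro b _ hb
      rw [← Category.assoc, hιπ, if_neg hb.symm]; simp
    · simp
  have hsum : ∀ (W : X.Opens) (m : Γ(free X r, W)), ∑ i, (ι i).app W ((π i).app W m) = m := by
    intro W m
    let ev : (free X r ⟶ free X r) →+ Γ(free X r, W) :=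
      { toFun f := f.app W m
        map_zero' := rfl
        map_add' _ _ := rfl }
    have := congrArg ev hπι
    rw [map_sum] at this
    exact this
  let one (W : X.Opens) : Γ(O, W) := (1 : Γ(X, W))
  refine ⟨fun i => (ι i).app ⊤ (one ⊤), fun W h => ?_⟩
  have key : ∀ a : Fin r → Γ(X, W), frameMap (free X r) (fun i => (ι i).app ⊤ (one ⊤)) W h a =
      ∑ i, (ι i).app W (show Γ(O, W) from a i) := by
    intro a
    rw [frameMap_apply]
    refine Finset.sum_congr rfl fun i _ => ?_
    rw [← app_res, ← Scheme.Modules.Hom.app_smul]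
    congr 1
    change a i * resO h 1 = a i
    rw [resO_one, mul_one]
  constructor
  · intro a b hab
    rw [key, key] at hab
    have hπ : ∀ (a : Fin r → Γ(X, W)) (j : Fin r),
        (π j).app W (∑ i, (ι i).app W (show Γ(O, W) from a i)) = (show Γ(O, W) from a j) := by
      intro a j
      rw [map_sum, Finset.sum_eq_single j]
      · change (ι j ≫ π j).app W _ = _
        rw [hιπ, if_pos rfl]; rfl
      · intro b _ hb
        change (ι b ≫ π j).app W _ = _
        rw [hιπ, if_neg hb]; rfl
      · simp
    funext j
    exact (hπ a j).symm.trans ((congrArg _ hab).trans (hπ b j))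
  · intro m
    refine ⟨fun i => (show Γ(X, W) from (π i).app W m), ?_⟩
    rw [key]
    exact hsum W m

/-! ### Frames and restriction to open subschemes -/

section Restrict

variable {Y : Scheme.{u}} (f : Y ⟶ X) [IsOpenImmersion f] (E : X.Modules) {r : ℕ}

/-- Sections of `E.restrict f` over `W'` are those of `E` over `f ''ᵁ W'`, with scalars transported
along `f.appIso`, so the two frame maps differ by a bijection on coefficients. -/
lemma isFrame_restrict_iff {W : Y.Opens} (e : Fin r → Γ(E, f ''ᵁ W)) :
    IsFrame (E.restrict f) (U := W) e ↔ IsFrame E e := by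
  have key : ∀ (W' : Y.Opens) (h : W' ≤ W),
      Function.Bijective (frameMap (E.restrict f) (U := W) e W' h) ↔
        Function.Bijective (frameMap E e (f ''ᵁ W') (f.image_mono h)) := by
    intro W' h
    have hb : Function.Bijective fun (a : Fin r → Γ(Y, W')) i => (f.appIso W').inv (a i) :=
      Function.Bijective.piMap fun _ =>
        (ConcreteCategory.isIso_iff_bijective (f.appIso W').inv).1 inferInstance
    exact Function.Bijective.of_comp_iff (frameMap E e (f ''ᵁ W') (f.image_mono h)) hb
  constructor
  · intro he W' h
    obtain ⟨W'', rfl⟩ : ∃ W'', W' = f ''ᵁ W'' :=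
      ⟨f ⁻¹ᵁ W', by
        rw [f.image_preimage_eq_opensRange_inf, inf_eq_right.2 (h.trans (f.image_le_opensRange _))]⟩
    have h' : W'' ≤ W := (f.image_le_image_iff _ _).1 h
    exact (key W'' h').1 (he W'' h')
  · exact fun he W' h => (key W' h).2 (he _ _)

end Restrict

lemma IsVectorBundle.exists_isFrame {E : X.Modules} {r : ℕ} (hE : IsVectorBundle E r) (x : X) :
    ∃ (U : X.Opens) (_ : x ∈ U) (e : Fin r → Γ(E, U)), IsFrame E e := by
  obtain ⟨U, hxU, ⟨i⟩⟩ := hE x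
  obtain ⟨e, he⟩ := exists_isFrame_free (U : Scheme.{u}) r
  exact ⟨U.ι ''ᵁ ⊤, by simpa using hxU, _,
    (isFrame_restrict_iff U.ι E (W := ⊤) _).1 (he.map_iso i.symm)⟩

lemma isVectorBundle_of_isFrame {E : X.Modules} {r : ℕ}
    (h : ∀ x : X, ∃ (U : X.Opens) (_ : x ∈ U) (e : Fin r → Γ(E, U)), IsFrame E e) :
    IsVectorBundle E r := by
  intro x
  obtain ⟨U, hxU, e, he⟩ := h x
  obtain ⟨e', he'⟩ := exists_isFrame_free (U : Scheme.{u}) r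
  refine ⟨U, hxU, nonempty_iso_of_isFrame ((isFrame_restrict_iff U.ι E (W := ⊤) _).2
    (he.restrict (U' := U.ι ''ᵁ ⊤) (by simp))) he'⟩

lemma isTrivial_of_isFrame {E : X.Modules} {r : ℕ} {e : Fin r → Γ(E, (⊤ : X.Opens))}
    (he : IsFrame E e) : IsTrivial E r := by
  obtain ⟨e', he'⟩ := exists_isFrame_free X r
  exact nonempty_iso_of_isFrame he he'

lemma isFrame_iff_isGenerator {L : X.Modules} {W : X.Opens} (e : Γ(L, W)) :
    IsFrame L (fun _ : Fin 1 => e) ↔ IsGenerator L e := by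
  refine forall₂_congr fun W' h => ?_
  rw [← Function.Bijective.of_comp_iff _ (Equiv.funUnique (Fin 1) Γ(X, W')).bijective]
  refine iff_of_eq (congrArg _ ?_)
  funext a
  simp [frameMap_apply]

/-! ### The image of the dual bundle under evaluation at a section -/

section Image

variable (E : X.Modules) (s : Γ(E, (⊤ : X.Opens)))

/-- `f` is locally of the form `φ(s)` with `φ` a section of the dual of `E`. -/
def IsLocalValue {W : X.Opens} (f : Γ(X, W)) : Prop :=
  ∀ x ∈ W, ∃ (W' : X.Opens) (h : W' ≤ W), x ∈ W' ∧ ∃ φ : DualSection E W',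
    φ.app W' le_rfl (res E le_top s) = resO h f

variable {E s}

lemma IsLocalValue.resO {W W' : X.Opens} {f : Γ(X, W)} (hf : IsLocalValue E s f) (h : W' ≤ W) :
    IsLocalValue E s (resO h f) := by
  intro x hx
  obtain ⟨W₁, h₁, hx₁, φ, hφ⟩ := hf x (h hx)
  refine ⟨W₁ ⊓ W', inf_le_right, ⟨hx₁, hx⟩, φ.restrict inf_le_left, ?_⟩
  have := φ.naturality W₁ (W₁ ⊓ W') le_rfl inf_le_left (res E le_top s)
  rw [hφ, resO_resO, res_res] at this
  rw [resO_resO, this]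
  rfl

lemma isLocalValue_of_local {W : X.Opens} {f : Γ(X, W)}
    (hf : ∀ x ∈ W, ∃ (W' : X.Opens) (h : W' ≤ W), x ∈ W' ∧
      IsLocalValue E s (SemiPositive.resO h f)) : IsLocalValue E s f := by
  intro x hx
  obtain ⟨W', h, hx', hW'⟩ := hf x hx
  obtain ⟨W₁, h₁, hx₁, φ, hφ⟩ := hW' x hx'
  exact ⟨W₁, h₁.trans h, hx₁, φ, by rw [hφ, resO_resO]⟩

lemma isLocalValue_app {W : X.Opens} (φ : DualSection E W) :
    IsLocalValue E s (φ.app W le_rfl (res E le_top s)) := fun _ hx =>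
  ⟨W, le_rfl, hx, φ, by rw [resO_self]⟩

variable (E s)

/-- The submodule of functions on `W` which are locally of the form `φ(s)`. -/
def localValues (W : X.Opens) : Submodule Γ(X, W) Γ(X, W) where
  carrier := {f | IsLocalValue E s f}
  zero_mem' := by
    have := isLocalValue_app (s := s) (0 : DualSection E W)
    simpa using this
  add_mem' {f g} hf hg := fun x hx => by
    obtain ⟨W₁, h₁, hx₁, φ, hφ⟩ := hf x hx
    obtain ⟨W₂, h₂, hx₂, ψ, hψ⟩ := hg x hx
    refine ⟨W₁ ⊓ W₂, inf_le_left.trans h₁, ⟨hx₁, hx₂⟩,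
      φ.restrict inf_le_left + ψ.restrict inf_le_right, ?_⟩
    have e₁ := φ.naturality W₁ (W₁ ⊓ W₂) le_rfl inf_le_left (res E le_top s)
    have e₂ := ψ.naturality W₂ (W₁ ⊓ W₂) le_rfl inf_le_right (res E le_top s)
    rw [hφ, resO_resO, res_res] at e₁
    rw [hψ, resO_resO, res_res] at e₂
    rw [resO_add, e₁, e₂]
    rfl
  smul_mem' a f hf := fun x hx => by
    obtain ⟨W₁, h₁, hx₁, φ, hφ⟩ := hf x hx
    refine ⟨W₁, h₁, hx₁, resO h₁ a • φ, ?_⟩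
    rw [smul_eq_mul, resO_mul, DualSection.smul_app, LinearMap.smul_apply, hφ, resO_self,
      smul_eq_mul]

/-- The restriction maps of the sheaf `localValues`. -/
def localValuesRestrict {W W' : X.Opens} (h : W' ≤ W) :
    localValues E s W →+ localValues E s W' where
  toFun f := ⟨resO h f.1, f.2.resO h⟩
  map_zero' := Subtype.ext (resO_zero h)
  map_add' f g := Subtype.ext (resO_add h f.1 g.1)

/-- The presheaf underlying the image of `E^∨ → 𝒪`, `φ ↦ φ(s)`. -/
def imagePresheaf : TopCat.Presheaf Ab X where
  obj U := .of (localValues E s U.unop)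
  map i := AddCommGrpCat.ofHom (localValuesRestrict E s (leOfHom i.unop))
  map_id _ := AddCommGrpCat.hom_ext <| AddMonoidHom.ext fun f : localValues E s _ =>
    Subtype.ext (resO_self le_rfl f.1)
  map_comp i j := AddCommGrpCat.hom_ext <| AddMonoidHom.ext fun f : localValues E s _ =>
    Subtype.ext (resO_resO (leOfHom j.unop) (leOfHom i.unop) f.1).symm

instance (U : (Opens X)ᵒᵖ) :
    Module (X.ringCatSheaf.obj.obj U) ((imagePresheaf E s).obj U) :=
  inferInstanceAs (Module Γ(X, U.unop) (localValues E s U.unop))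

lemma imagePresheaf_isSheaf : (imagePresheaf E s).IsSheaf := by
  rw [TopCat.Presheaf.isSheaf_iff_isSheafUniqueGluing]
  intro ι U sf' hsf
  let sf : ∀ i, localValues E s (U i) := sf'
  obtain ⟨b, hb, hb'⟩ := X.sheaf.existsUnique_gluing' U (iSup U) (fun i => homOfLE (le_iSup U i))
    le_rfl (fun i => (sf i).1) fun i j => congrArg Subtype.val (hsf i j)
  have hb₁ : ∀ i, resO (le_iSup U i) b = (sf i).1 := hb
  refine ⟨(⟨b, isLocalValue_of_local fun x hx => ?_⟩ : localValues E s (iSup U)), fun i => ?_,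
    fun c hc => ?_⟩
  · obtain ⟨i, hi⟩ := Opens.mem_iSup.1 hx
    refine ⟨U i, le_iSup U i, hi, ?_⟩
    rw [hb₁]
    exact (sf i).2
  · exact Subtype.ext (hb i)
  · let c' : localValues E s (iSup U) := c
    exact Subtype.ext (hb' c'.1 fun i => congrArg Subtype.val (hc i))

/-- The image of the morphism `E^∨ → 𝒪`, `φ ↦ φ(s)`, as a sheaf of modules. -/
def dualImage : X.Modules where
  val := PresheafOfModules.ofPresheaf (R := X.ringCatSheaf.obj) (imagePresheaf E s) (by
    intro U V f r m
    exact Subtype.ext (resO_mul (leOfHom f.unop) r (show localValues E s U.unop from m).1))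
  isSheaf := imagePresheaf_isSheaf E s

variable {E s}

/-- A section of the image of `E^∨`, from the corresponding function. -/
def dualImage.mk {W : X.Opens} (f : Γ(X, W)) (hf : IsLocalValue E s f) : Γ(dualImage E s, W) :=
  (⟨f, hf⟩ : localValues E s W)

/-- The function underlying a section of the image of `E^∨`. -/
def dualImage.val {W : X.Opens} : Γ(dualImage E s, W) →ₗ[Γ(X, W)] Γ(X, W) :=
  (localValues E s W).subtype

lemma dualImage.isLocalValue_val {W : X.Opens} (m : Γ(dualImage E s, W)) :
    IsLocalValue E s (dualImage.val m) :=
  (show localValues E s W from m).2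

lemma dualImage.val_injective {W : X.Opens} :
    Function.Injective (dualImage.val : Γ(dualImage E s, W) → Γ(X, W)) :=
  Subtype.val_injective

lemma dualImage.val_res {W W' : X.Opens} (h : W' ≤ W) (m : Γ(dualImage E s, W)) :
    dualImage.val (res (dualImage E s) h m) = resO h (dualImage.val m) := rfl

variable (E s)

/-- The surjection `E^∨ → dualImage E s`, `φ ↦ φ(s)`. -/
def toDualImage : dual E ⟶ dualImage E s :=
  homMk (fun U =>
    { toFun φ := dualImage.mk ((show DualSection E U from φ).app U le_rfl (res E le_top s))
        (isLocalValue_app _)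
      map_add' _ _ := rfl
      map_smul' a φ := dualImage.val_injective (by
        change resO le_rfl a * _ = _
        rw [resO_self]
        rfl) })
    fun U U' h φ => dualImage.val_injective (by
      change resO h ((show DualSection E U from φ).app U le_rfl (res E le_top s)) =
        (show DualSection E U from φ).app U' _ (res E le_top s)
      rw [DualSection.naturality, res_res])

/-- A section of the image lifts to the dual only locally; this is enough, since equality of
sections of the sheaf `Z` is local. -/
instance epi_toDualImage : Epi (toDualImage E s) where
  left_cancellation {Z} f g hfg := by
    refine Scheme.Modules.hom_ext _ _ fun U => ?_
    ext m
    refine res_ext Z fun x hx => ?_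
    obtain ⟨W, h, hxW, φ, hφ⟩ := dualImage.isLocalValue_val m x hx
    refine ⟨W, h, hxW, ?_⟩
    rw [← app_res, ← app_res]
    have : res (dualImage E s) h m = (toDualImage E s).app W (show Γ(dual E, W) from φ) :=
      dualImage.val_injective hφ.symm
    rw [this]
    exact congrArg (fun f : dual E ⟶ Z => f.app W (show Γ(dual E, W) from φ)) hfg

end Image

/-! ### Local generators of the image -/

lemma germ_resO {W W' : X.Opens} (h : W' ≤ W) {x : X} (hx : x ∈ W') (f : Γ(X, W)) :
    X.presheaf.germ W' x hx (resO h f) = X.presheaf.germ W x (h hx) f :=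
  X.presheaf.germ_res_apply (homOfLE h) x hx f

/-- Finitely many germs of functions are represented over a common neighbourhood. -/
lemma exists_germ_eq {n : ℕ} {x : X} (U : X.Opens) (hx : x ∈ U) (g : Fin n → X.presheaf.stalk x) :
    ∃ (W : X.Opens) (_ : W ≤ U) (hxW : x ∈ W) (b : Fin n → Γ(X, W)),
      ∀ i, X.presheaf.germ W x hxW (b i) = g i := by
  choose V hV b hb using fun i => TopCat.Presheaf.exists_germ_eq X.presheaf (g i)
  have hxW : x ∈ U ⊓ Finset.univ.inf V := by
    refine ⟨hx, ?_⟩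
    simp [hV]
  have hle : ∀ i, U ⊓ Finset.univ.inf V ≤ V i := fun i =>
    inf_le_right.trans (Finset.inf_le (Finset.mem_univ i))
  exact ⟨_, inf_le_left, hxW, fun i => resO (hle i) (b i), fun i => by rw [germ_resO, hb]⟩

/-- Bézout: `τ` generates the ideal spanned by the `a i`. It is applied in a stalk, to the germs of
the coordinates of `s`. -/
lemma exists_common_divisor {R : Type*} [CommRing R] [IsPrincipalIdealRing R] {n : ℕ}
    (a : Fin n → R) :
    ∃ (τ : R) (b c : Fin n → R), (∀ i, a i = b i * τ) ∧ τ = ∑ i, c i * a i := by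
  obtain ⟨τ, hτ⟩ := IsPrincipalIdealRing.principal (Ideal.span (Set.range a))
  have h₁ : ∀ i, ∃ b, a i = b * τ := fun i => by
    have : a i ∈ Ideal.span (Set.range a) := Ideal.subset_span ⟨i, rfl⟩
    rw [hτ] at this
    obtain ⟨b, hb⟩ := Submodule.mem_span_singleton.1 this
    exact ⟨b, hb.symm⟩
  have h₂ : τ ∈ Ideal.span (Set.range a) := by
    rw [hτ]
    exact Submodule.mem_span_singleton_self τ
  obtain ⟨c, hc⟩ := Ideal.mem_span_range_iff_exists_fun.1 h₂
  choose b hb using h₁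
  exact ⟨τ, b, c, hb, hc.symm⟩

section

variable {E : X.Modules} {s : Γ(E, (⊤ : X.Opens))}

/-- Linearity of `φ` on the expansion of `s` in the frame. Consequently a common divisor of the
coordinates divides every value `φ(s)`. -/
lemma DualSection.app_eq_sum {U W : X.Opens} {r : ℕ} {e : Fin r → Γ(E, U)} (he : IsFrame E e)
    (hW : W ≤ U) (φ : DualSection E W) :
    φ.app W le_rfl (res E le_top s) =
      ∑ i, resO hW (he.coord U le_rfl (res E le_top s) i) * φ.app W le_rfl (res E hW (e i)) := by
  have := he.sum_coord hW (res E le_top s)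
  rw [← this, map_sum]
  refine Finset.sum_congr rfl fun i _ => ?_
  rw [map_smul, smul_eq_mul, ← he.coord_res le_rfl hW, res_res]

/-- The linear combination of the coordinate functions with coefficients `c` over `W`. -/
lemma exists_dualSection {U W : X.Opens} {r : ℕ} {e : Fin r → Γ(E, U)} (he : IsFrame E e)
    (hW : W ≤ U) (c : Fin r → Γ(X, W)) : ∃ φ : DualSection E W, φ.app W le_rfl (res E le_top s) =
      ∑ i, c i * resO hW (he.coord U le_rfl (res E le_top s) i) := by
  refine ⟨∑ i, c i • (he.dualSection i).restrict hW, ?_⟩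
  let ev : DualSection E W →+ Γ(X, W) :=
    { toFun φ := φ.app W le_rfl (res E le_top s)
      map_zero' := rfl
      map_add' _ _ := rfl }
  change ev _ = _
  rw [map_sum]
  refine Finset.sum_congr rfl fun i _ => ?_
  change resO le_rfl (c i) * he.coord W _ (res E le_top s) i = _
  rw [resO_self, ← he.coord_res le_rfl hW, res_res]

variable [IsIntegral X]

/-- A function which divides all coordinates of `s` and is a linear combination of them generates
the image of `E^∨` under evaluation at `s`. -/
lemma isGenerator_of_coord {U W : X.Opens} {r : ℕ} {e : Fin r → Γ(E, U)} (he : IsFrame E e)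
    (hW : W ≤ U) (t : Γ(X, W)) (ht : t ≠ 0) (b : Fin r → Γ(X, W))
    (hb : ∀ i, resO hW (he.coord U le_rfl (res E le_top s) i) = b i * t)
    (htv : IsLocalValue E s t) : IsGenerator (dualImage E s) (dualImage.mk t htv) := by
  -- On an integral scheme germ maps are injective, so all germs of `t` are nonzero and `t` can be
  -- cancelled.
  have inj : ∀ (W' : X.Opens) (h : W' ≤ W) (a b : Γ(X, W')),
      a * resO h t = b * resO h t → a = b := by
    intro W' h a b hab
    refine resO_ext_of_mem fun x hx => ⟨W', le_rfl, hx, congrArg _ ?_⟩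
    apply germ_injective_of_isIntegral X x hx
    have := congrArg (X.presheaf.germ W' x hx) hab
    rw [map_mul, map_mul, germ_resO] at this
    refine mul_right_cancel₀ (fun h0 => ht ?_) this
    exact germ_injective_of_isIntegral X x (h hx) (h0.trans (map_zero _).symm)
  intro W' h
  constructor
  · intro a b hab
    exact inj W' h a b (congrArg dualImage.val hab)
  · intro m
    -- Quotients by `t` are unique, hence local ones glue. Where the section is `φ(s)`, the quotient
    -- is `∑ b i * φ(e i)`.
    obtain ⟨a, ha⟩ := exists_glue_of_unique (W := W')
      (fun V hV (a : Γ(X, V)) => a * resO (hV.trans h) t = resO hV (dualImage.val m))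
      (fun V V' hV hV' a ha => by rw [← resO_resO hV' (hV.trans h), ← resO_mul, ha, resO_resO])
      (fun V hV a b ha hb => inj V (hV.trans h) a b (ha.trans hb.symm))
      (fun x hx => by
        obtain ⟨V, hV, hxV, φ, hφ⟩ := dualImage.isLocalValue_val m x hx
        refine ⟨V, hV, hxV, ∑ i, resO (hV.trans h) (b i) *
          φ.app V le_rfl (res E ((hV.trans h).trans hW) (e i)), ?_⟩
        rw [← hφ, DualSection.app_eq_sum he ((hV.trans h).trans hW), Finset.sum_mul]
        refine Finset.sum_congr rfl fun i _ => ?_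
        rw [← resO_resO (hV.trans h) hW, hb, resO_mul]
        ring)
    refine ⟨a, dualImage.val_injective (resO_ext_of_mem fun x hx => ?_)⟩
    obtain ⟨V, hV, hxV, hVa⟩ := ha x hx
    refine ⟨V, hV, hxV, ?_⟩
    rw [← hVa]
    change resO hV (a * resO h t) = _
    rw [resO_mul, resO_resO]

/-- If the local ring at `x` is a principal ideal ring, the image of `E^∨` under evaluation at `s`
is generated near `x` by a linear combination of the coordinates of `s`. -/
lemma exists_isGenerator {U : X.Opens} {r : ℕ} {e : Fin r → Γ(E, U)} (he : IsFrame E e)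
    {x : X} (hx : x ∈ U) [IsPrincipalIdealRing (X.presheaf.stalk x)]
    (hs : res E (le_top : U ≤ ⊤) s ≠ 0) :
    ∃ (W : X.Opens) (_ : x ∈ W) (t : Γ(X, W)) (_ : t ≠ 0) (ht : IsLocalValue E s t),
      IsGenerator (dualImage E s) (dualImage.mk t ht) := by
  set a := he.coord U le_rfl (res E le_top s) with ha
  obtain ⟨τ, β, γ, hβ, hγ⟩ := exists_common_divisor fun i => X.presheaf.germ U x hx (a i)
  obtain ⟨W₁, hW₁, hxW₁, b, hb⟩ := exists_germ_eq U hx β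
  obtain ⟨W, hW, hxW, c, hc⟩ := exists_germ_eq W₁ hxW₁ γ
  let t : Γ(X, W) := ∑ i, c i * resO (hW.trans hW₁) (a i)
  have hgt : X.presheaf.germ W x hxW t = τ := by
    rw [hγ, map_sum]
    refine Finset.sum_congr rfl fun i _ => ?_
    rw [map_mul, hc, germ_resO]
  -- Divisibility holds in the stalk at `x`, and injectivity of germs carries it to all of `W`.
  have hbt : ∀ i, resO (hW.trans hW₁) (a i) = resO hW (b i) * t := fun i => by
    apply germ_injective_of_isIntegral X x hxW
    rw [map_mul, hgt, germ_resO, germ_resO, hb, hβ]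
  have ht0 : t ≠ 0 := by
    intro h0
    apply hs
    rw [← (he.coord U le_rfl).map_eq_zero_iff, ← ha]
    funext i
    apply germ_injective_of_isIntegral X x hx
    rw [hβ, ← hgt, h0, map_zero, mul_zero]
    exact (map_zero _).symm
  have htv : IsLocalValue E s t := by
    obtain ⟨φ, hφ⟩ := exists_dualSection (s := s) he (hW.trans hW₁) c
    change _ = t at hφ
    rw [← hφ]
    exact isLocalValue_app φ
  refine ⟨W, hxW, t, ht0, htv, isGenerator_of_coord he (hW.trans hW₁) t ht0 _ hbt htv⟩

/-- On an integral scheme, a section of a vector bundle which vanishes on a nonempty open set is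
zero. -/
lemma eq_zero_of_res_eq_zero {r : ℕ} (hE : IsVectorBundle E r) {U : X.Opens} {x : X} (hx : x ∈ U)
    (hs : res E (le_top : U ≤ ⊤) s = 0) : s = 0 := by
  refine res_ext E fun y _ => ?_
  obtain ⟨W, hyW, e, he⟩ := hE.exists_isFrame y
  refine ⟨W, le_top, hyW, ?_⟩
  rw [res_zero, ← (he.coord W le_rfl).map_eq_zero_iff]
  funext i
  -- By irreducibility `U` and `W` meet, and a coordinate over `W` is determined by its germ at a
  -- common point.
  obtain ⟨z, hzU, hzW⟩ := nonempty_preirreducible_inter U.isOpen W.isOpen ⟨x, hx⟩ ⟨y, hyW⟩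
  have hz : z ∈ U ⊓ W := ⟨hzU, hzW⟩
  apply germ_injective_of_isIntegral X z hzW
  have h0 : res E (inf_le_right : U ⊓ W ≤ W) (res E (le_top : W ≤ ⊤) s) = 0 := by
    rw [res_res, ← res_res E (inf_le_left : U ⊓ W ≤ U) le_top, hs, res_zero]
  have := he.coord_res le_rfl (inf_le_right : U ⊓ W ≤ W) (res E le_top s) i
  rw [h0, map_zero] at this
  rw [← germ_resO (inf_le_right : U ⊓ W ≤ W) hz, ← this]
  simp

lemma IsVectorBundle.exists_isGenerator_dualImage {r : ℕ} (hE : IsVectorBundle E r) (hs : s ≠ 0)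
    (x : X) [IsPrincipalIdealRing (X.presheaf.stalk x)] :
    ∃ (W : X.Opens) (_ : x ∈ W) (t : Γ(X, W)) (_ : t ≠ 0) (ht : IsLocalValue E s t),
      IsGenerator (dualImage E s) (dualImage.mk t ht) := by
  obtain ⟨U, hxU, e, he⟩ := hE.exists_isFrame x
  exact exists_isGenerator he hxU fun h => hs (eq_zero_of_res_eq_zero hE hxU h)

lemma isLineBundle_dualImage {r : ℕ} (hE : IsVectorBundle E r) (hs : s ≠ 0)
    (hX : ∀ x : X, IsPrincipalIdealRing (X.presheaf.stalk x)) : IsLineBundle (dualImage E s) := by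
  refine isVectorBundle_of_isFrame fun x => ?_
  have := hX x
  obtain ⟨W, hxW, t, _, ht, hgen⟩ := hE.exists_isGenerator_dualImage hs x
  exact ⟨W, hxW, _, (isFrame_iff_isGenerator _).2 hgen⟩

end

/-! ### Points and orders of vanishing on curves -/

section Curve

/-- Points correspond to irreducible closed sets, so the dimension of the space is that of the
specialization order, in which `x ≤ y` means `y ⤳ x` and coheight is codimension. -/
lemma coheight_le_one (hX : topologicalKrullDim X = 1) (x : X) : Order.coheight x ≤ 1 := by
  have h : Order.krullDim X = 1 := by
    rw [← hX]
    exact (Order.krullDim_eq_of_orderIso irreducibleSetEquivPoints).symm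
  have := (Order.coheight_le_krullDim x).trans_eq h
  exact_mod_cast this

variable [IsIntegral X]

/-- By regularity the maximal ideal needs as many generators as the dimension of the stalk, which is
the coheight of `x`, at most one. A Noetherian local domain with cotangent space of dimension at
most one is a principal ideal ring. -/
lemma isPrincipalIdealRing_stalk (hX : topologicalKrullDim X = 1) (x : X)
    [IsRegularLocalRing (X.presheaf.stalk x)] : IsPrincipalIdealRing (X.presheaf.stalk x) := by
  have h₁ : (IsLocalRing.maximalIdeal (X.presheaf.stalk x)).spanFinrank ≤ 1 := by
    have h := IsRegularLocalRing.spanFinrank_maximalIdeal (R := X.presheaf.stalk x)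
    rw [ringKrullDim_stalk_eq_coheight] at h
    have h' : (Order.coheight x : WithBot ℕ∞) ≤ 1 := by exact_mod_cast coheight_le_one hX x
    rw [← h] at h'
    exact_mod_cast h'
  refine ((tfae_of_isNoetherianRing_of_isLocalRing_of_isDomain (X.presheaf.stalk x)).out 0 5).2 ?_
  rwa [← IsLocalRing.spanFinrank_maximalIdeal_eq_finrank_cotangentSpace]

lemma lt_top_of_ne {x : X} (hx : x ≠ genericPoint X) : x < ⊤ :=
  lt_of_le_not_ge le_top fun h => hx ((show x ⤳ genericPoint X from h).antisymm
    (genericPoint_specializes x)).eq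

/-- Otherwise `x < y < ⊤` would be a chain of length two. -/
lemma eq_genericPoint_of_lt (hX : topologicalKrullDim X = 1) {x y : X} (h : x < y) :
    y = genericPoint X := by
  by_contra hy
  have h₁ := Order.coheight_add_one_le h
  have h₂ := Order.coheight_add_one_le (lt_top_of_ne hy)
  have h₃ := coheight_le_one hX x
  rw [Order.coheight_top, zero_add] at h₂
  have : (1 : ℕ∞) + 1 ≤ 1 := (add_le_add_left h₂ 1).trans (h₁.trans h₃)
  exact absurd this (by decide)

/-- On a curve, the complement of a nonempty open set is finite. -/
lemma finite_compl [NoetherianSpace X] (hX : topologicalKrullDim X = 1) (U : X.Opens)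
    (hU : genericPoint X ∈ U) : ((U : Set X)ᶜ).Finite := by
  obtain ⟨S, hS, hSc, hSi, hSU⟩ :=
    NoetherianSpace.exists_finite_set_isClosed_irreducible U.isOpen.isClosed_compl
  choose! g hg using fun Z (hZ : Z ∈ S) => QuasiSober.sober (hSi Z hZ) (hSc Z hZ)
  refine (hS.image g).subset fun x hx => ?_
  obtain ⟨Z, hZ, hxZ⟩ : x ∈ ⋃₀ S := hSU ▸ hx
  refine ⟨Z, hZ, ?_⟩
  have hle : x ≤ g Z := (hg Z hZ).specializes hxZ
  -- If `x` were strictly below the generic point of `Z`, the latter would be the generic point of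
  -- `X`, which lies in `U`.
  by_cases hge : g Z ≤ x
  · exact (show x ⤳ g Z from hge).antisymm ((hg Z hZ).specializes hxZ) |>.eq.symm
  · have hgU : g Z ∈ (U : Set X)ᶜ := by
      rw [hSU]
      exact ⟨Z, hZ, (hg Z hZ).mem⟩
    rw [eq_genericPoint_of_lt hX (lt_of_le_not_ge hle hge)] at hgU
    exact absurd hU hgU

variable [IsLocallyNoetherian X]

/-- In codimension one the rational function comes from the local ring at `x`; elsewhere
`Scheme.ord` is zero by convention. -/
lemma ord_germ_nonneg {W : X.Opens} {x : X} (hx : x ∈ W) (hW : genericPoint X ∈ W) {t : Γ(X, W)}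
    (ht : t ≠ 0) :
    0 ≤ Scheme.ord (X.presheaf.germ W (genericPoint X) hW t : X.functionField) x := by
  by_cases hc : Order.coheight x = 1
  · have : Nonempty W := ⟨⟨x, hx⟩⟩
    have : Ring.KrullDimLE 1 (X.presheaf.stalk x) := krullDimLE_of_coheight_le hc.le
    have h0 : X.presheaf.germ W x hx t ≠ 0 := fun h =>
      ht (germ_injective_of_isIntegral X x hx (h.trans (map_zero _).symm))
    have h1 : (X.presheaf.germ W (genericPoint X) hW t : X.functionField) =
        algebraMap (X.presheaf.stalk x) X.functionField (X.presheaf.germ W x hx t) :=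
      (Scheme.algebraMap_germ_eq_germToFunctionField X hx t).symm
    rw [h1, Scheme.le_ord_iff hc ((map_ne_zero_iff _ (FaithfulSMul.algebraMap_injective _ _)).2 h0)]
    exact Ring.ordFrac_ge_one_of_ne_zero h0
  · rw [Scheme.ord_eq_zero_of_coheight_neq_one hc]

/-- The stalk at the generic point is a field, so a nonzero nonunit germ forces codimension one. The
stalk is then a discrete valuation ring, where order zero means unit. -/
lemma ord_germ_ne_zero (hX : topologicalKrullDim X = 1) {W : X.Opens} {x : X} (hx : x ∈ W)
    (hW : genericPoint X ∈ W) [IsPrincipalIdealRing (X.presheaf.stalk x)] {t : Γ(X, W)}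
    (ht : t ≠ 0) (hu : ¬ IsUnit (X.presheaf.germ W x hx t)) :
    Scheme.ord (X.presheaf.germ W (genericPoint X) hW t : X.functionField) x ≠ 0 := by
  have h0 : X.presheaf.germ W x hx t ≠ 0 := fun h =>
    ht (germ_injective_of_isIntegral X x hx (h.trans (map_zero _).symm))
  have hc : Order.coheight x = 1 := by
    refine le_antisymm (coheight_le_one hX x) ?_
    by_cases hxt : x = genericPoint X
    · subst hxt
      exact absurd (IsUnit.mk0 (G₀ := X.functionField) _ h0) hu
    · have := Order.coheight_add_one_le (lt_top_of_ne hxt)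
      rwa [Order.coheight_top, zero_add] at this
  have : Nonempty W := ⟨⟨x, hx⟩⟩
  have : Ring.KrullDimLE 1 (X.presheaf.stalk x) := krullDimLE_of_coheight_le hc.le
  have h1 : (X.presheaf.germ W (genericPoint X) hW t : X.functionField) =
      algebraMap (X.presheaf.stalk x) X.functionField (X.presheaf.germ W x hx t) :=
    (Scheme.algebraMap_germ_eq_germToFunctionField X hx t).symm
  have : IsDiscreteValuationRing (X.presheaf.stalk x) :=
    { not_a_field' := fun hm => h0 (by
        have : X.presheaf.germ W x hx t ∈ IsLocalRing.maximalIdeal (X.presheaf.stalk x) := hu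
        rwa [hm] at this) }
  rw [h1, Ne, Scheme.ord_eq_iff hc ((map_ne_zero_iff _ (FaithfulSMul.algebraMap_injective _ _)).2 h0)]
  intro h
  exact hu (Ring.isUnit_iff_ordFrac_one_of_isDiscreteValuationRing.2 h)

end Curve

/-! ### The degree of the image of the dual bundle -/

section Degree

variable (E : X.Modules) (s : Γ(E, (⊤ : X.Opens)))

/-- The set of points at which `s` does not vanish. -/
def nonvanishing : X.Opens :=
  sSup {W : X.Opens | IsLocalValue E s (1 : Γ(X, W))}

variable {E s}

lemma isLocalValue_one : IsLocalValue E s (1 : Γ(X, nonvanishing E s)) :=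
  isLocalValue_of_local fun x hx => by
    obtain ⟨W, hW, hxW⟩ := Opens.mem_sSup.1 hx
    have hle : W ≤ nonvanishing E s := fun y hy => Opens.mem_sSup.2 ⟨W, hW, hy⟩
    refine ⟨W, hle, hxW, ?_⟩
    rw [resO_one]
    exact hW

/-- Local values form a submodule, so `1 = t⁻¹ * t` is one wherever `t` is invertible. -/
lemma mem_nonvanishing_of_isUnit {W : X.Opens} {x : X} (hx : x ∈ W) {t : Γ(X, W)}
    (ht : IsLocalValue E s t) (hu : IsUnit (X.presheaf.germ W x hx t)) : x ∈ nonvanishing E s := by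
  have hle := X.basicOpen_le t
  refine Opens.mem_sSup.2 ⟨X.basicOpen t, ?_, (X.mem_basicOpen t x hx).2 hu⟩
  have hb : IsUnit (resO hle t) := RingedSpace.isUnit_res_basicOpen _ t
  obtain ⟨b, hb⟩ := hb.exists_left_inv
  have := (localValues E s (X.basicOpen t)).smul_mem b (ht.resO hle)
  rw [smul_eq_mul, hb] at this
  exact this

/-- Near `x` the function `1` is a combination of the coordinates; in a local ring they cannot all
lie in the maximal ideal. -/
lemma exists_isUnit_coord {U : X.Opens} {r : ℕ} {e : Fin r → Γ(E, U)} (he : IsFrame E e)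
    {x : X} (hx : x ∈ U) (hs : x ∈ nonvanishing E s) :
    ∃ i, IsUnit (X.presheaf.germ U x hx (he.coord U le_rfl (res E le_top s) i)) := by
  obtain ⟨W, hW, hxW, φ, hφ⟩ := isLocalValue_one.resO
    (inf_le_left : nonvanishing E s ⊓ U ≤ nonvanishing E s) x ⟨hs, hx⟩
  rw [resO_one, resO_one, DualSection.app_eq_sum he (hW.trans inf_le_right)] at hφ
  have h := congrArg (X.presheaf.germ W x hxW) hφ
  rw [map_sum, map_one] at h
  by_contra! hu
  have : (1 : X.presheaf.stalk x) ∈ IsLocalRing.maximalIdeal (X.presheaf.stalk x) := by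
    rw [← h]
    refine Ideal.sum_mem _ fun i _ => ?_
    rw [map_mul, germ_resO]
    exact Ideal.mul_mem_right _ _ (hu i)
  exact this isUnit_one

variable [IsIntegral X]

lemma genericPoint_mem {W : X.Opens} {x : X} (hx : x ∈ W) : genericPoint X ∈ W :=
  (genericPoint_specializes x).mem_open W.isOpen hx

variable [IsLocallyNoetherian X]

/-- On a nonsingular curve, the image of `E^∨` under evaluation at a nonzero section of `E` with
zeros has negative degree. -/
lemma exists_hasDegree_dualImage [NoetherianSpace X] (hX : topologicalKrullDim X = 1)
    (hreg : ∀ x : X, IsPrincipalIdealRing (X.presheaf.stalk x)) {r : ℕ} (hE : IsVectorBundle E r)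
    (hs : s ≠ 0) {x₀ : X} (hx₀ : x₀ ∉ nonvanishing E s) :
    ∃ d < 0, HasDegree (dualImage E s) d := by
  choose W hxW t ht0 htv hgen using fun x => hE.exists_isGenerator_dualImage hs x
  have hgW : ∀ x, genericPoint X ∈ W x := fun x => genericPoint_mem (hxW x)
  have hgU : genericPoint X ∈ nonvanishing E s := by
    refine mem_nonvanishing_of_isUnit (hgW (genericPoint X)) (htv _)
      (IsUnit.mk0 (G₀ := X.functionField) _ fun h => ht0 (genericPoint X) ?_)
    exact germ_injective_of_isIntegral X _ (hgW _) (h.trans (map_zero _).symm)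
  -- The constant function `1` belongs to the image away from the zeros of `s`. In terms of the
  -- generator it is `t⁻¹ • t`, whence the order `-ord t` below.
  let σ : RationalSection (dualImage E s) :=
    { U := nonvanishing E s
      mem := hgU
      s := dualImage.mk 1 isLocalValue_one
      ne_zero := fun h => by
        have h1 : (1 : Γ(X, nonvanishing E s)) = 0 := congrArg dualImage.val h
        have := congrArg (X.presheaf.germ _ _ hgU) h1
        rw [map_one, map_zero] at this
        exact one_ne_zero this }
  let n : X → ℤ := fun x =>
    -Scheme.ord (X.presheaf.germ (W x) (genericPoint X) (hgW x) (t x) : X.functionField) x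
  have hn : ∀ x, n x ≤ 0 := fun x => neg_nonpos.2 (ord_germ_nonneg (hxW x) (hgW x) (ht0 x))
  have hn₀ : n x₀ < 0 := by
    refine lt_of_le_of_ne (hn x₀) (neg_ne_zero.2 (ord_germ_ne_zero hX (hxW x₀) _ (ht0 x₀) ?_))
    exact fun hu => hx₀ (mem_nonvanishing_of_isUnit _ (htv x₀) hu)
  have hord : ∀ x, ∃ a : Γ(X, nonvanishing E s ⊓ W x), a * resO inf_le_right (t x) = 1 := by
    intro x
    obtain ⟨a, ha⟩ := (hgen x _ inf_le_right).2 (res _ inf_le_left σ.s)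
    refine ⟨a, (congrArg dualImage.val ha).trans ?_⟩
    rw [dualImage.val_res]
    exact resO_one _
  choose a ha using hord
  have hgUW : ∀ x, genericPoint X ∈ nonvanishing E s ⊓ W x := fun x => ⟨hgU, hgW x⟩
  have hna : ∀ x, Scheme.ord (X.presheaf.germ (nonvanishing E s ⊓ W x) (genericPoint X)
      (hgUW x) (a x) : X.functionField) x = n x := by
    intro x
    have h := congrArg (X.presheaf.germ (nonvanishing E s ⊓ W x) (genericPoint X)
      (hgUW x)) (ha x)
    rw [map_mul, map_one, germ_resO] at h
    have h' := congrArg (fun f : X.functionField => Scheme.ord f x) h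
    have h1 : Scheme.ord (1 : X.functionField) x = 0 := by
      have := Scheme.ord_mul (x := x) (one_ne_zero (α := X.functionField)) one_ne_zero
      rw [mul_one] at this
      lia
    have hne := mul_ne_zero_iff.1 (h.trans_ne (one_ne_zero (α := X.functionField)))
    change Scheme.ord (_ * _ : X.functionField) x = _ at h'
    rw [Scheme.ord_mul hne.1 hne.2] at h'
    exact eq_neg_of_add_eq_zero_left (h'.trans h1)
  -- Where `s` does not vanish, `a x` is a unit with inverse `t x` and the order is zero; the
  -- remaining points are finite in number.
  have hsupp : n.support.Finite := by
    refine (finite_compl hX (nonvanishing E s) hgU).subset fun x hx hxU => hx ?_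
    have : Nonempty (nonvanishing E s ⊓ W x : X.Opens) := ⟨⟨x, hxU, hxW x⟩⟩
    rw [← hna]
    exact Scheme.ord_of_isUnit (IsUnit.of_mul_eq_one _ (ha x)) (show x ∈ nonvanishing E s ⊓ W x from ⟨hxU, hxW x⟩)
  let D : X →₀ ℤ := Finsupp.ofSupportFinite n hsupp
  refine ⟨D.sum fun _ n => n, ?_, σ, D, fun x => ?_, rfl⟩
  · refine Finset.sum_neg' (fun x _ => hn x) ⟨x₀, ?_, hn₀⟩
    exact Finsupp.mem_support_iff.2 hn₀.ne
  · refine ⟨W x, hxW x, hgW x, _, hgen x, a x, dualImage.val_injective ?_, hna x⟩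
    rw [dualImage.val_res]
    exact (resO_one _).trans (ha x).symm

/-- The degree is invariant under isomorphisms. -/
lemma HasDegree.of_iso {L L' : X.Modules} (i : L ≅ L') {d : ℤ} (h : HasDegree L d) :
    HasDegree L' d := by
  obtain ⟨σ, D, hD, hd⟩ := h
  have hinv : ∀ (U : X.Opens) (m : Γ(L, U)), i.inv.app U (i.hom.app U m) = m := fun U m =>
    congrArg (fun f : L ⟶ L => f.app U m) i.hom_inv_id
  refine ⟨⟨σ.U, σ.mem, i.hom.app σ.U σ.s, fun h => σ.ne_zero ?_⟩, D, fun x => ?_, hd⟩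
  · rw [← hinv _ σ.s, h, map_zero]
  · obtain ⟨W, hxW, hW, e, he, a, ha, hao⟩ := hD x
    refine ⟨W, hxW, hW, i.hom.app W e, ?_, a, ?_, hao⟩
    · rw [← isFrame_iff_isGenerator] at he ⊢
      exact he.map_iso i
    · rw [← app_res, ← app_res]
      exact (congrArg _ ha).trans (Scheme.Modules.Hom.app_smul _ _ _)

end Degree

end

/-! ### Nonvanishing of sections -/

lemma IsCompleteCurve.isLocallyNoetherian {C : Scheme.{0}} {p : C ⟶ Spec (.of ℂ)}
    (hC : IsCompleteCurve p) : IsLocallyNoetherian C := by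
  have := hC.isProper
  exact LocallyOfFiniteType.isLocallyNoetherian p

lemma IsCompleteCurve.compactSpace {C : Scheme.{0}} {p : C ⟶ Spec (.of ℂ)}
    (hC : IsCompleteCurve p) : CompactSpace C := by
  have := hC.isProper
  exact QuasiCompact.compactSpace_of_compactSpace p

/-- A nonzero section of a bundle with semi-positive dual vanishes nowhere. -/
lemma mem_nonvanishing_of_isSemiPositive {V : Scheme.{0}} {p : V ⟶ Spec (.of ℂ)}
    (hV : IsNonsingularCompleteCurve p) {E : V.Modules} {r : ℕ} (hE : IsVectorBundle E r)
    (hdual : IsSemiPositive p (dual E)) {s : Γ(E, (⊤ : V.Opens))} (hs : s ≠ 0) (x : V) :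
    x ∈ nonvanishing E s := by
  have := hV.isIntegral
  have := hV.toIsCompleteCurve.isLocallyNoetherian
  have := hV.toIsCompleteCurve.compactSpace
  have : IsNoetherian V := {}
  have hpid : ∀ x : V, IsPrincipalIdealRing (V.presheaf.stalk x) := fun x =>
    have := hV.regular x
    isPrincipalIdealRing_stalk hV.dim_eq_one x
  by_contra hx
  obtain ⟨d, hd, hdeg⟩ := exists_hasDegree_dualImage hV.dim_eq_one hpid hE hs hx
  obtain ⟨B, hB⟩ := hdual
  -- The universal property over the identity of `V` turns the line bundle quotient into a section
  -- `h` of `π` with `h^* 𝒪(1)` isomorphic to the image. Nefness is then tested on `V` itself,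
  -- mapped by `h`.
  obtain ⟨h, ⟨w, i, -⟩, -⟩ := B.existsUnique_lift (𝟙 V) (dualImage E s)
    (isLineBundle_dualImage hE hs hpid)
    ((Scheme.Modules.pullbackId V).hom.app (dual E) ≫ toDualImage E s) (epi_comp _ _)
  have hp : h ≫ B.π ≫ p = p := by rw [← Category.assoc, w, Category.id_comp]
  exact absurd (hB V h (hp.symm ▸ hV.toIsCompleteCurve) d (hdeg.of_iso i.symm)) (not_le.2 hd)

/-! ### Evaluation of global sections at a closed point -/

section Evaluation

variable {X : Scheme.{0}} (p : X ⟶ Spec (.of ℂ))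

/-- The structure map `ℂ → Γ(X, 𝒪)` of a scheme over `ℂ`. -/
def scalars : ℂ →+* Γ(X, (⊤ : X.Opens)) :=
  ((Scheme.ΓSpecIso (.of ℂ)).inv ≫ p.appTop).hom

/-- The complex vector space structure on global sections. -/
abbrev globalModule (E : X.Modules) : Module ℂ Γ(E, (⊤ : X.Opens)) :=
  Module.compHom _ (scalars p)

/-- The structure map `ℂ → κ(x)`. -/
def residueScalars (x : X) : ℂ →+* X.residueField x :=
  (X.evaluation ⊤ x trivial).hom.comp (scalars p)

/-- This is the Nullstellensatz, in the form of `residueFieldIsoBase`. What remains is to identify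
that isomorphism with evaluation of scalars at `x`, which is checked after applying `Spec`, using
that `p` factors through `X.toSpecΓ`. -/
lemma residueScalars_bijective [LocallyOfFiniteType p] {x : X} (hx : IsClosed {x}) :
    Function.Bijective (residueScalars p x) := by
  have hp : p = X.toSpecΓ ≫ Spec.map p.appTop ≫ Spec.map (Scheme.ΓSpecIso (.of ℂ)).inv := by
    rw [← Scheme.toSpecΓ_naturality_assoc, ← SpecMap_ΓSpecIso_hom, ← Spec.map_comp, Iso.inv_hom_id,
      Spec.map_id, Category.comp_id]
  have h' : (residueFieldIsoBase p x hx).inv =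
      (Scheme.ΓSpecIso (.of ℂ)).inv ≫ p.appTop ≫ X.presheaf.germ ⊤ x trivial ≫ X.residue x := by
    apply Spec.map_injective
    rw [SpecMap_residueFieldIsoBase_inv]
    conv_lhs => rw [hp]
    simp only [Scheme.fromSpecResidueField, Spec.map_comp, Category.assoc,
      Scheme.fromSpecStalk_toSpecΓ_assoc]
  have h : residueScalars p x = (residueFieldIsoBase p x hx).inv.hom := by
    rw [h']
    rfl
  rw [h]
  exact (ConcreteCategory.isIso_iff_bijective (residueFieldIsoBase p x hx).inv).1 inferInstance

/-- The algebra structure on the residue field. -/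
abbrev residueAlgebra (x : X) : Algebra ℂ (X.residueField x) :=
  (residueScalars p x).toAlgebra

variable {E : X.Modules} {U : X.Opens} {r : ℕ} {e : Fin r → Γ(E, U)}

lemma evaluation_resO {W W' : X.Opens} (h : W' ≤ W) {x : X} (hx : x ∈ W') (f : Γ(X, W)) :
    X.evaluation W' x hx (resO h f) = X.evaluation W x (h hx) f :=
  congrArg (X.residue x) (germ_resO h hx f)

/-- The value at a point of a global section, in coordinates. -/
def evalAt (he : IsFrame E e) {x : X} (hx : x ∈ U) :
    letI := globalModule p E
    letI := residueAlgebra p x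
    Γ(E, (⊤ : X.Opens)) →ₗ[ℂ] (Fin r → X.residueField x) :=
  letI := globalModule p E
  letI := residueAlgebra p x
  { toFun m i := X.evaluation U x hx (he.coord U le_rfl (res E le_top m) i)
    map_add' m n := by
      funext i
      rw [res_add, map_add, Pi.add_apply, map_add]
      rfl
    map_smul' c m := by
      funext i
      change X.evaluation U x hx (he.coord U le_rfl (res E le_top (scalars p c • m)) i) =
        residueScalars p x c * _
      rw [res_smul, map_smul, Pi.smul_apply, smul_eq_mul, map_mul, evaluation_resO]
      rfl }

/-- A nowhere vanishing section has a coordinate that is a unit at `x`, hence nonzero in the residue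
field. -/
lemma evalAt_injective (he : IsFrame E e) {x : X} (hx : x ∈ U)
    (hE : ∀ s : Γ(E, (⊤ : X.Opens)), s ≠ 0 → x ∈ nonvanishing E s) :
    Function.Injective (evalAt p he hx) := by
  let := globalModule p E
  let := residueAlgebra p x
  rw [injective_iff_map_eq_zero]
  intro s hs
  by_contra h0
  obtain ⟨i, hi⟩ := exists_isUnit_coord he hx (hE s h0)
  have := hi.map (X.residue x).hom
  exact this.ne_zero (congrFun hs i)

variable {p}

lemma rank_pi_residueField [LocallyOfFiniteType p] {x : X} (hx : IsClosed {x}) (r : ℕ) :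
    letI := residueAlgebra p x
    Module.rank ℂ (Fin r → X.residueField x) = r := by
  let := residueAlgebra p x
  let φ : ℂ ≃ₗ[ℂ] X.residueField x :=
    LinearEquiv.ofBijective (Algebra.linearMap ℂ (X.residueField x)) (residueScalars_bijective p hx)
  rw [← (LinearEquiv.piCongrRight fun _ : Fin r => φ).rank_eq, rank_fin_fun]

/-- If the determinant of the coordinates of `r` sections with respect to a frame is invertible
over `W`, then these sections form a frame over `W`. -/
lemma isFrame_res_of_isUnit_det (he : IsFrame E e) (s : Fin r → Γ(E, U)) {W : X.Opens} (hW : W ≤ U)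
    (hdet : IsUnit (resO hW (Matrix.of fun i j => he.coord U le_rfl (s j) i).det)) :
    IsFrame E fun j => res E hW (s j) := by
  intro W' h
  let A : Matrix (Fin r) (Fin r) Γ(X, W') :=
    Matrix.of fun i j => resO (h.trans hW) (he.coord U le_rfl (s j) i)
  have hA : IsUnit A.det := by
    have h1 := hdet.map (X.presheaf.map (homOfLE h).op).hom
    change IsUnit (resO h _) at h1
    rw [resO_resO] at h1
    change IsUnit ((X.presheaf.map (homOfLE (h.trans hW)).op).hom _) at h1
    rw [RingHom.map_det] at h1
    exact h1
  -- In the coordinates of `e`, the frame map of the sections `s j` is multiplication by `A`.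
  have key : ⇑(he.coord W' (h.trans hW)) ∘ frameMap E (fun j => res E hW (s j)) W' h =
      A.mulVec := by
    funext a i
    rw [Function.comp_apply, frameMap_apply, map_sum, Finset.sum_apply]
    refine Finset.sum_congr rfl fun j _ => ?_
    rw [map_smul, Pi.smul_apply, smul_eq_mul, res_res, he.coord_res le_rfl (h.trans hW), mul_comm]
    rfl
  rw [← Function.Bijective.of_comp_iff' (he.coord W' (h.trans hW)).bijective, key]
  have hu : IsUnit A := (Matrix.isUnit_iff_isUnit_det A).2 hA
  exact ⟨Matrix.mulVec_injective_of_isUnit hu, Matrix.mulVec_surjective_iff_isUnit.2 hu⟩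

/-- A basis of the space of global sections which evaluates to a basis of the fibre at a closed
point is a frame near this point. -/
lemma exists_isFrame_res [LocallyOfFiniteType p] (he : IsFrame E e) {x : X} (hxU : x ∈ U)
    (s : Fin r → Γ(E, (⊤ : X.Opens)))
    (hspan : letI := globalModule p E; Submodule.span ℂ (Set.range s) = ⊤)
    (hsurj : Function.Surjective (evalAt p he hxU)) :
    ∃ (W : X.Opens) (_ : x ∈ W), IsFrame E fun j => res E (le_top : W ≤ ⊤) (s j) := by
  let := globalModule p E
  let := residueAlgebra p x
  let A : Matrix (Fin r) (Fin r) Γ(X, U) :=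
    Matrix.of fun i j => he.coord U le_rfl (res E le_top (s j)) i
  let B : Matrix (Fin r) (Fin r) (X.residueField x) := A.map (X.evaluation U x hxU)
  -- The columns of `B` are the values of the `s j` at `x`. They span because the `s j` span the
  -- global sections and evaluation is onto.
  have hB : IsUnit B := by
    rw [← Matrix.mulVec_surjective_iff_isUnit]
    intro v
    obtain ⟨m, rfl⟩ := hsurj v
    obtain ⟨c, rfl⟩ := (Submodule.mem_span_range_iff_exists_fun ℂ).1
      ((Submodule.eq_top_iff'.1 hspan) m)
    refine ⟨fun j => residueScalars p x (c j), ?_⟩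
    funext i
    have := congrFun (map_sum (evalAt p he hxU) (fun j => c j • s j) Finset.univ) i
    rw [this, Finset.sum_apply]
    symm
    refine Finset.sum_congr rfl fun j _ => ?_
    have := congrFun ((evalAt p he hxU).map_smul (c j) (s j)) i
    exact this.trans (mul_comm _ _)
  have hdet : X.evaluation U x hxU A.det ≠ 0 := by
    have : (X.evaluation U x hxU).hom A.det = B.det := RingHom.map_det _ _
    exact this ▸ ((Matrix.isUnit_iff_isUnit_det B).1 hB).ne_zero
  have hle := X.basicOpen_le A.det
  refine ⟨X.basicOpen A.det, (X.evaluation_ne_zero_iff_mem_basicOpen x hxU _).1 hdet, ?_⟩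
  have := isFrame_res_of_isUnit_det he (fun j => res E le_top (s j)) hle
    (RingedSpace.isUnit_res_basicOpen _ A.det)
  simpa only [res_res] using this

end Evaluation

end SemiPositive

end

/-! ### The bound on global sections and the case of equality -/

theorem lemma4p14 {V : Scheme.{0}} (p : V ⟶ Spec (.of ℂ))
    (hV : SemiPositive.IsNonsingularCompleteCurve p)
    (E : V.Modules) (r : ℕ) (hE : SemiPositive.IsVectorBundle E r)
    (hdual : SemiPositive.IsSemiPositive p (SemiPositive.dual E)) :
    SemiPositive.h0 p E ≤ r ∧ (SemiPositive.h0 p E = r → SemiPositive.IsTrivial E r) := by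
  open SemiPositive in
  have := hV.isIntegral
  have := hV.isProper
  have := hV.toIsCompleteCurve.compactSpace
  have hnv : ∀ (x : V) (s : Γ(E, (⊤ : V.Opens))), s ≠ 0 → x ∈ nonvanishing E s := fun x s hs =>
    mem_nonvanishing_of_isSemiPositive hV hE hdual hs x
  let := globalModule p E
  have hh0 : h0 p E = Module.rank ℂ Γ(E, (⊤ : V.Opens)) := rfl
  rw [hh0]
  constructor
  · obtain ⟨x, -, hx⟩ := isClosed_univ.exists_closed_singleton (Set.univ_nonempty (α := V))
    obtain ⟨U, hxU, e, he⟩ := hE.exists_isFrame x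
    let := residueAlgebra p x
    rw [← rank_pi_residueField (p := p) hx r]
    exact LinearMap.rank_le_of_injective (evalAt p he hxU) (evalAt_injective p he hxU (hnv x))
  · intro hr
    have hfin : Module.Finite ℂ Γ(E, (⊤ : V.Opens)) := by
      rw [← Module.rank_lt_aleph0_iff, hr]
      exact Cardinal.natCast_lt_aleph0
    let b := Module.finBasisOfFinrankEq ℂ Γ(E, (⊤ : V.Opens)) (Module.finrank_eq_of_rank_eq hr)
    refine isTrivial_of_isFrame (e := b) (isFrame_of_local fun x _ => ?_)
    -- By compactness the closure of `x` contains a closed point `y`. Every open neighbourhood of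
    -- `y` contains `x`, so a frame near `y` suffices.
    obtain ⟨y, hyx, hy⟩ := (isClosed_closure (s := {x})).exists_closed_singleton
      (Set.singleton_nonempty x).closure
    obtain ⟨U, hyU, e, he⟩ := hE.exists_isFrame y
    let := residueAlgebra p y
    have hrk := rank_pi_residueField (p := p) hy r
    have : Module.Finite ℂ (Fin r → V.residueField y) := by
      rw [← Module.rank_lt_aleph0_iff, hrk]
      exact Cardinal.natCast_lt_aleph0
    have hsurj := (LinearMap.injective_iff_surjective_of_finrank_eq_finrank (f := evalAt p he hyU)
      (by rw [Module.finrank_eq_of_rank_eq hr, Module.finrank_eq_of_rank_eq hrk])).1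
      (evalAt_injective p he hyU (hnv y))
    obtain ⟨W, hyW, hf⟩ := exists_isFrame_res he hyU b b.span_eq hsurj
    exact ⟨W, le_top, (specializes_iff_mem_closure.2 hyx).mem_open W.isOpen hyW, hf⟩
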